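/- Compact groups are assumed to be Hausdorff. A compact Lie group is a compact group having a neighborhood of the identity that contains no nontrivial subgroup; $\mathbb{T}$ is the circle group, and the weight $w(G)$ is the least cardinality of a base of the topology of $G$ (cardinals are identified with initial ordinals). A transfinite inverse sequence $\langle G_\alpha, p_\alpha^\beta\rangle_{\alpha\le\beta<\kappa}$ of topological groups and continuous homomorphisms $p_\alpha^\beta\colon G_\beta\to G_\alpha$ is continuous if for every limit ordinal $\delta<\kappa$ the group $G_\delta$, with the maps $p_\alpha^\delta$, is the inverse limit of $\langle G_\alpha, p_\alpha^\beta\rangle_{\alpha\le\beta<\delta}$. Let $G$ be a compact Abelian group. Then there are an ordinal $\kappa>0$ and a continuous inverse sequence $\langle G_\alpha,p_\alpha^\beta\rangle_{\alpha\le\beta<\kappa}$ of compact groups and continuous homomorphisms such that 1. $G=\varprojlim_{\alpha<\kappa}G_\alpha$ (up to isomorphism of topological groups); 2. $G_0$ is the trivial group; 3. for every $\alpha$ with $\alpha+1<\kappa$, either $p_\alpha^{\alpha+1}$ is an epimorphism (a surjective homomorphism) with finite kernel, or, up to isomorphism of topological groups, $G_{\alpha+1}=G_\alpha\times\mathbb{T}$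 and $p_\alpha^{\alpha+1}$ is the standard projection $G_\alpha\times\mathbb{T}\to G_\alpha$; 4. if $G$ is not a Lie group, then $\kappa=w(G)$. -/

import Mathlib

open Topology

universe u v w

/-- The weight `w(X)` of a topological space: the least cardinality of a base of its topology. -/
noncomputable def topWeight (X : Type u) [TopologicalSpace X] : Cardinal.{u} :=
  sInf {c | ∃ B : Set (Set X), TopologicalSpace.IsTopologicalBasis B ∧ Cardinal.mk B = c}

/-- A compact Lie group: a compact (Hausdorff) topological group in which some neighborhood of the
identity contains no nontrivial subgroup. -/
def IsCompactLieGroup (G : Type u) [Group G] [TopologicalSpace G] [IsTopologicalGroup G] : Prop :=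
  CompactSpace G ∧ T2Space G ∧
    ∃ U ∈ 𝓝 (1 : G), ∀ H : Subgroup G, (H : Set G) ⊆ U → H = ⊥

/-- An inverse system of topological groups and continuous homomorphisms, indexed by `I`. The
bonding map `p_i^j : G_j → G_i` is `bond h` for `h : i ≤ j`. -/
structure TopGroupInvSystem (I : Type v) [Preorder I] where
  obj : I → Type u
  [group : ∀ i, Group (obj i)]
  [topologicalSpace : ∀ i, TopologicalSpace (obj i)]
  [isTopologicalGroup : ∀ i, IsTopologicalGroup (obj i)]
  bond : ∀ {i j : I}, i ≤ j → (obj j →ₜ* obj i)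
  bond_refl : ∀ (i : I) (x : obj i), bond (le_refl i) x = x
  bond_bond : ∀ {i j k : I} (hij : i ≤ j) (hjk : j ≤ k) (x : obj k),
    bond hij (bond hjk x) = bond (hij.trans hjk) x

namespace TopGroupInvSystem

attribute [instance] group topologicalSpace isTopologicalGroup

variable {I : Type v} [Preorder I]

/-- The inverse limit: the group of threads, a topological subgroup of the product. -/
def limit (S : TopGroupInvSystem.{u} I) : Subgroup (∀ i, S.obj i) where
  carrier := {x | ∀ (i j : I) (h : i ≤ j), S.bond h (x j) = x i}
  mul_mem' := fun {a b} ha hb i j h => by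
    simp only [Pi.mul_apply, map_mul, ha i j h, hb i j h]
  one_mem' := fun i j h => by simp only [Pi.one_apply, map_one]
  inv_mem' := fun {a} ha i j h => by simp only [Pi.inv_apply, map_inv, ha i j h]

/-- The restriction of an inverse system to a set of indices. -/
def restrict (S : TopGroupInvSystem.{u} I) (s : Set I) : TopGroupInvSystem.{u} s where
  obj i := S.obj i
  bond {i j} h := S.bond (show (i : I) ≤ j from h)
  bond_refl i x := S.bond_refl i x
  bond_bond hij hjk x := S.bond_bond (show _ ≤ _ from hij) (show _ ≤ _ from hjk) x

/-- `G`, with the projections `π i : G → G_i`, is the limit of the system: the map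
`g ↦ (π i g)_i` is an isomorphism of topological groups of `G` onto the group of threads. -/
def IsLimitCone (S : TopGroupInvSystem.{u} I) {G : Type w} [Group G] [TopologicalSpace G]
    (π : ∀ i, G →ₜ* S.obj i) : Prop :=
  ∃ e : G ≃ₜ* S.limit, ∀ (g : G) (i : I), (e g : ∀ i, S.obj i) i = π i g

/-- A transfinite inverse sequence `(G_α)_{α < κ}` is continuous if for each limit ordinal
`δ < κ` the group `G_δ`, with the bonding maps `p_α^δ`, is the limit of `(G_α)_{α < δ}`. -/
def IsContinuousSeq {κ : Ordinal.{w}} (S : TopGroupInvSystem.{u} (Set.Iio κ)) : Prop :=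
  ∀ δ : Set.Iio κ, Order.IsSuccLimit (δ : Ordinal.{w}) →
    (S.restrict (Set.Iio δ)).IsLimitCone
      (fun α => S.bond (show (α : Set.Iio κ) ≤ δ from le_of_lt α.2))

/-- The successor bonding map `p_α^{α+1} : G_{α+1} → G_α` of a sequence `(G_α)_{α < κ}`. -/
def succBond {κ : Ordinal.{w}} (S : TopGroupInvSystem.{u} (Set.Iio κ)) (α : Ordinal.{w})
    (h : α + 1 < κ) :
    S.obj ⟨α + 1, h⟩ →ₜ* S.obj ⟨α, (Order.lt_add_one_iff.mpr le_rfl).trans h⟩ :=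
  S.bond (Subtype.mk_le_mk.mpr (Order.lt_add_one_iff.mpr le_rfl).le)

end TopGroupInvSystem

/-- A continuous epimorphism with finite kernel. -/
def IsFiniteKernelEpi {A B : Type*} [Group A] [TopologicalSpace A] [Group B] [TopologicalSpace B]
    (p : A →ₜ* B) : Prop :=
  Function.Surjective p ∧ {x : A | p x = 1}.Finite

/-- Up to an isomorphism `A ≅ B × 𝕋` of topological groups, `p` is the standard projection
`B × 𝕋 → B`. -/
def IsCircleProjection {A B : Type*} [Group A] [TopologicalSpace A] [Group B] [TopologicalSpace B]
    (p : A →ₜ* B) : Prop :=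
  ∃ e : A ≃ₜ* B × Circle, ∀ x : A, (e x).1 = p x

/-! Characters separate the points of a compact abelian group G, and one character per member of a
base already suffices. Index such a family by ordinals, let N_α be the common kernel of the
characters below α, and put G_α = G/N_α. Then N_0 = G, limit stages are intersections, and the total
intersection is trivial, so compactness gives continuity and the limit
(`isLimitCone_of_surjective`). At a successor, χ_α embeds N_α/N_{α+1} in the circle as a closed
subgroup, hence finite or everything; in the second case the projection together with χ_α identifies
G_{α+1} with G_α × 𝕋 (`quotientBond_inf_ker`).

Separation comes from Gelfand theory: translations on L² and a self-adjoint convolution operator T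
lie in a commutative C⋆-algebra, and a Gelfand character φ with φ(T) ≠ 0 restricts to a continuous
character g ↦ φ(L_g). -/

/-- A commuting unitary representation of `G` in a C⋆-algebra, norm continuous after multiplication
by a commuting self-adjoint `T`, gives a continuous character of `G` that is nontrivial at every
`g₀` moving `T`. -/
theorem exists_circle_character_of_unitary {A G : Type*} [CStarAlgebra A] [Group G]
    [TopologicalSpace G] (L : G →* A) (hstar : ∀ g, star (L g) = L g⁻¹)
    (hL : ∀ g h, Commute (L g) (L h)) (T : A) (hT : IsSelfAdjoint T)
    (hLT : ∀ g, Commute (L g) T) (hc : Continuous fun g => L g * T) (g₀ : G)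
    (hg₀ : L g₀ * T ≠ T) : ∃ χ : G →ₜ* Circle, χ g₀ ≠ 1 := by
  let s : Set A := insert T (Set.range L)
  have hcomm : ∀ a ∈ s, ∀ b ∈ s, a * b = b * a := by
    rintro a (rfl | ⟨g, rfl⟩) b (rfl | ⟨h, rfl⟩)
    · rfl
    · exact (hLT h).symm
    · exact hLT g
    · exact hL g h
  have hs : star s = s := by
    ext a
    constructor
    · rintro (h | ⟨g, h⟩)
      · left; rw [← star_star a, h, hT.star_eq]
      · right; exact ⟨g⁻¹, by rw [← hstar, h, star_star]⟩
    · rintro (rfl | ⟨g, rfl⟩)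
      · left; exact hT.star_eq
      · right; exact ⟨g⁻¹, (hstar g).symm⟩
  -- The double centralizer of a commuting star-closed set is commutative and norm closed, so
  -- Gelfand theory applies to it.
  let C : StarSubalgebra ℂ A :=
    StarSubalgebra.centralizer ℂ (StarSubalgebra.centralizer ℂ s : Set A)
  have hC : (C : Set A) = s.centralizer.centralizer := by
    rw [StarSubalgebra.coe_centralizer_centralizer, hs, Set.union_self]
  have hsC : s ⊆ C := hC ▸ Set.subset_centralizer_centralizer
  have hclosed : IsClosed (C : Set A) := hC ▸ Set.isClosed_centralizer _
  have hmul : ∀ x y : C, x * y = y * x := fun x y => Subtype.ext <|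
    Set.centralizer_centralizer_comm_of_comm hcomm _ (hC ▸ x.2) _ (hC ▸ y.2)
  let _ : CStarAlgebra C := StarSubalgebra.cstarAlgebra C
  let _ : CommCStarAlgebra C := { ‹CStarAlgebra C› with mul_comm := hmul }
  let t : C := ⟨T, hsC (Or.inl rfl)⟩
  let l : G →* C := L.codRestrict C fun g => hsC (Or.inr ⟨g, rfl⟩)
  have hne : l g₀ * t - t ≠ 0 := fun h => hg₀ (congrArg Subtype.val (sub_eq_zero.1 h))
  obtain ⟨φ, hφ⟩ : ∃ φ : WeakDual.characterSpace ℂ C, φ (l g₀ * t - t) ≠ 0 := by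
    by_contra! h
    refine hne ((gelfandTransform_isometry C).injective ?_)
    ext φ
    simpa using h φ
  -- The second factor allows division by φ(T), which yields continuity although L itself need not
  -- be norm continuous; the first gives nontriviality at g₀.
  have hφ' : (φ (l g₀) - 1) * φ t ≠ 0 := by
    rwa [sub_mul, one_mul, ← map_mul, ← map_sub]
  have hlc : Continuous fun g => l g * t := hc.subtype_mk _
  have hφc : Continuous fun g => φ (l g) := by
    have h1 : Continuous fun g => φ (l g * t) := (map_continuous φ).comp hlc
    have h2 : (fun g => φ (l g)) = fun g => φ (l g * t) / φ t := by
      ext g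
      rw [map_mul, mul_div_cancel_right₀ _ (right_ne_zero_of_mul hφ')]
    rw [h2]
    exact h1.div_const _
  have hnorm : ∀ g, ‖φ (l g)‖ = 1 := fun g => by
    have h1 : star (l g) = l g⁻¹ := Subtype.ext (hstar g)
    have h2 : star (φ (l g)) * φ (l g) = 1 := by
      rw [← map_star φ, h1, ← map_mul, ← map_mul, inv_mul_cancel, map_one, map_one]
    rw [← pow_eq_one_iff_of_nonneg (norm_nonneg _) two_ne_zero]
    have h3 := congrArg norm h2
    rwa [norm_mul, norm_star, norm_one, ← sq] at h3
  refine ⟨⟨⟨⟨fun g => ⟨φ (l g), mem_sphere_zero_iff_norm.2 (hnorm g)⟩, ?_⟩, ?_⟩, ?_⟩, ?_⟩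
  · ext; simp
  · intro g h
    refine Circle.ext ?_
    rw [Circle.coe_mul]
    exact (congrArg φ (map_mul l g h)).trans (map_mul φ _ _)
  · exact hφc.subtype_mk _
  · intro h
    exact left_ne_zero_of_mul hφ' (sub_eq_zero.2 (congrArg Subtype.val h))

/-! ### Convolution operators on L² and separation of points -/

section Characters

open MeasureTheory Measure
open scoped ENNReal InnerProductSpace

section KernelOperator

variable {X : Type*} [TopologicalSpace X] [CompactSpace X] [MeasurableSpace X] (μ : Measure X)

/-- The integral operator on `L²` with kernel given by a continuous family of `L²` functions. -/
noncomputable def kernelOperator (F : C(X, Lp ℂ 2 μ)) : Lp ℂ 2 μ →L[ℂ] C(X, ℂ) :=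
  LinearMap.mkContinuous
    { toFun := fun h => ⟨fun x => ⟪F x, h⟫_ℂ, by fun_prop⟩
      map_add' := fun h k => by ext x; exact inner_add_right (𝕜 := ℂ) (F x) h k
      map_smul' := fun c h => by ext x; exact inner_smul_right (𝕜 := ℂ) (F x) h c }
    ‖F‖ fun h => by
      rw [ContinuousMap.norm_le _ (by positivity)]
      intro x
      exact (norm_inner_le_norm _ _).trans
        (mul_le_mul_of_nonneg_right (F.norm_coe_le_norm x) (norm_nonneg _))

theorem kernelOperator_apply (F : C(X, Lp ℂ 2 μ)) (h : Lp ℂ 2 μ) (x : X) :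
    kernelOperator μ F h x = ⟪F x, h⟫_ℂ := rfl

theorem norm_kernelOperator_le (F : C(X, Lp ℂ 2 μ)) : ‖kernelOperator μ F‖ ≤ ‖F‖ :=
  LinearMap.mkContinuous_norm_le _ (norm_nonneg _) _

theorem continuous_kernelOperator : Continuous (kernelOperator μ) := by
  refine LipschitzWith.continuous (K := 1) (LipschitzWith.of_dist_le_mul fun F F' => ?_)
  have h : kernelOperator μ F - kernelOperator μ F' = kernelOperator μ (F - F') := by
    ext h x
    simp [kernelOperator_apply, inner_sub_left]
  rw [dist_eq_norm, h, NNReal.coe_one, one_mul, dist_eq_norm]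
  exact norm_kernelOperator_le μ _

end KernelOperator

section Translation

variable {G : Type*} [CommGroup G] [TopologicalSpace G] [IsTopologicalGroup G]

/-- Translation of continuous functions. -/
def ContinuousMap.mulTranslate {X : Type*} [TopologicalSpace X] (g : G) (f : C(G, X)) : C(G, X) :=
  f.comp ⟨fun x => g * x, continuous_const_mul g⟩

variable [CompactSpace G] [MeasurableSpace G] [BorelSpace G] (μ : Measure G) [μ.IsHaarMeasure]

/-- Translation as an isometry of the `L²` space of Haar measure. -/
noncomputable def l2Translate (g : G) : Lp ℂ 2 μ →ₗᵢ[ℂ] Lp ℂ 2 μ :=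
  Lp.compMeasurePreservingₗᵢ ℂ (fun x => g * x) (measurePreserving_mul_left μ g)

theorem l2Translate_toLp (g : G) (f : C(G, ℂ)) :
    l2Translate μ g (ContinuousMap.toLp 2 μ ℂ f) =
      ContinuousMap.toLp 2 μ ℂ (f.mulTranslate g) := rfl

theorem continuousMap_toLp_dense [μ.WeaklyRegular] :
    DenseRange (ContinuousMap.toLp 2 μ ℂ : C(G, ℂ) →L[ℂ] Lp ℂ 2 μ) :=
  ContinuousMap.toLp_denseRange ℂ μ ℂ (by norm_num)

theorem l2Translate_mul [μ.WeaklyRegular] (g h : G) (f : Lp ℂ 2 μ) :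
    l2Translate μ (g * h) f = l2Translate μ g (l2Translate μ h f) := by
  refine (continuousMap_toLp_dense μ).induction_on (p := fun f => l2Translate μ (g * h) f =
    l2Translate μ g (l2Translate μ h f)) f (isClosed_eq ?_ ?_) fun k => ?_
  · fun_prop
  · fun_prop
  · simp only [l2Translate_toLp]
    congr 1
    ext x
    simp [ContinuousMap.mulTranslate, mul_left_comm, mul_assoc]

theorem l2Translate_one [μ.WeaklyRegular] (f : Lp ℂ 2 μ) : l2Translate μ 1 f = f := by
  refine (continuousMap_toLp_dense μ).induction_on (p := fun f => l2Translate μ 1 f = f) f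
    (isClosed_eq ?_ ?_) fun k => ?_
  · fun_prop
  · fun_prop
  · simp only [l2Translate_toLp]
    congr 1
    ext x
    simp [ContinuousMap.mulTranslate]

/-- The regular representation of a compact abelian group. -/
noncomputable def l2Regular [μ.WeaklyRegular] : G →* (Lp ℂ 2 μ →L[ℂ] Lp ℂ 2 μ) where
  toFun g := (l2Translate μ g).toContinuousLinearMap
  map_one' := by ext1 f; exact l2Translate_one μ f
  map_mul' g h := by ext1 f; exact l2Translate_mul μ g h f

theorem l2Regular_apply [μ.WeaklyRegular] (g : G) (f : Lp ℂ 2 μ) :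
    l2Regular μ g f = l2Translate μ g f := rfl

theorem inner_l2Regular [μ.WeaklyRegular] (g : G) (f k : Lp ℂ 2 μ) :
    ⟪l2Regular μ g f, k⟫_ℂ = ⟪f, l2Regular μ g⁻¹ k⟫_ℂ := by
  have h : k = l2Regular μ g (l2Regular μ g⁻¹ k) := by
    rw [← mul_apply_eq_comp, ← map_mul, mul_inv_cancel, map_one,
      one_apply_eq_self]
  conv_lhs => rw [h]
  exact (l2Translate μ g).inner_map_map _ _

theorem star_l2Regular [μ.WeaklyRegular] (g : G) : star (l2Regular μ g) = l2Regular μ g⁻¹ := by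
  rw [ContinuousLinearMap.star_eq_adjoint, eq_comm, ContinuousLinearMap.eq_adjoint_iff]
  intro f k
  rw [inner_l2Regular, inv_inv]

/-- The family of translates `x ↦ f (x y⁻¹)` of a continuous function, in `L²`. -/
noncomputable def convKernel (f : C(G, ℂ)) : C(G, Lp ℂ 2 μ) :=
  ⟨fun x => ContinuousMap.toLp 2 μ ℂ ((⟨fun p : G × G => f (p.1 * p.2⁻¹), by fun_prop⟩ :
    C(G × G, ℂ)).curry x), by fun_prop⟩

theorem convKernel_apply (f : C(G, ℂ)) (x : G) :
    convKernel μ f x = ContinuousMap.toLp 2 μ ℂ ⟨fun y => f (x * y⁻¹), by fun_prop⟩ := rfl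

theorem l2Translate_convKernel (f : C(G, ℂ)) (g x : G) :
    l2Translate μ g (convKernel μ f x) = convKernel μ f (g⁻¹ * x) := by
  rw [convKernel_apply, l2Translate_toLp, convKernel_apply]
  congr 1
  ext y
  simp only [ContinuousMap.mulTranslate, ContinuousMap.comp_apply, ContinuousMap.coe_mk, mul_inv]
  congr 1
  rw [← mul_assoc, mul_comm x]

/-- The convolution operator on `L²`. -/
noncomputable def convOperator (f : C(G, ℂ)) : Lp ℂ 2 μ →L[ℂ] Lp ℂ 2 μ :=
  (ContinuousMap.toLp 2 μ ℂ).comp (kernelOperator μ (convKernel μ f))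

theorem convOperator_apply (f : C(G, ℂ)) (h : Lp ℂ 2 μ) : convOperator μ f h =
    ContinuousMap.toLp 2 μ ℂ (kernelOperator μ (convKernel μ f) h) := rfl

theorem l2Regular_mul_convOperator [μ.WeaklyRegular] (f : C(G, ℂ)) (g : G) :
    l2Regular μ g * convOperator μ f =
      (ContinuousMap.toLp 2 μ ℂ).comp (kernelOperator μ ((convKernel μ f).mulTranslate g)) := rfl

theorem commute_l2Regular_convOperator [μ.WeaklyRegular] (f : C(G, ℂ)) (g : G) :
    Commute (l2Regular μ g) (convOperator μ f) := by
  rw [Commute, SemiconjBy, l2Regular_mul_convOperator]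
  ext1 h
  rw [mul_apply_eq_comp, convOperator_apply, ContinuousLinearMap.comp_apply]
  congr 1
  ext x
  rw [kernelOperator_apply, kernelOperator_apply, ← star_star (l2Regular μ g), star_l2Regular,
    ContinuousLinearMap.star_eq_adjoint, ContinuousLinearMap.adjoint_inner_right,
    l2Regular_apply, l2Translate_convKernel, inv_inv]
  rfl

/-- Translating the output translates the kernel, and currying a jointly continuous map makes the
translated kernel vary continuously in the uniform norm. -/
theorem continuous_l2Regular_mul_convOperator [μ.WeaklyRegular] (f : C(G, ℂ)) :
    Continuous fun g => l2Regular μ g * convOperator μ f := by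
  simp only [l2Regular_mul_convOperator]
  refine ((ContinuousLinearMap.compL ℂ (Lp ℂ 2 μ) C(G, ℂ) (Lp ℂ 2 μ)
    (ContinuousMap.toLp 2 μ ℂ)).continuous.comp (continuous_kernelOperator μ)).comp
    (g := fun F => (ContinuousMap.toLp 2 μ ℂ).comp (kernelOperator μ F)) ?_
  exact (⟨fun p : G × G => convKernel μ f (p.1 * p.2), by fun_prop⟩ :
    C(G × G, Lp ℂ 2 μ)).curry.continuous

/-- The kernel is Hermitian, so Fubini gives symmetry on continuous functions, which are dense. -/
theorem isSelfAdjoint_convOperator [μ.WeaklyRegular] (f : C(G, ℂ))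
    (hf : ∀ x, f x⁻¹ = starRingEnd ℂ (f x)) : IsSelfAdjoint (convOperator μ f) := by
  rw [ContinuousLinearMap.isSelfAdjoint_iff_isSymmetric]
  intro h k
  show ⟪convOperator μ f h, k⟫_ℂ = ⟪h, convOperator μ f k⟫_ℂ
  refine (continuousMap_toLp_dense μ).induction_on₂ (p := fun h k =>
    ⟪convOperator μ f h, k⟫_ℂ = ⟪h, convOperator μ f k⟫_ℂ) (isClosed_eq ?_ ?_) (fun a b => ?_) h k
  · fun_prop
  · fun_prop
  · have hI : ∀ (c : C(G, ℂ)) (x : G), kernelOperator μ (convKernel μ f)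
        (ContinuousMap.toLp 2 μ ℂ c) x = ∫ y, c y * f (y * x⁻¹) ∂μ := by
      intro c x
      rw [kernelOperator_apply, convKernel_apply, ContinuousMap.inner_toLp]
      refine integral_congr_ae (Filter.Eventually.of_forall fun y => ?_)
      simp only [ContinuousMap.coe_mk]
      rw [← hf, mul_inv_rev, inv_inv]
    rw [convOperator_apply, convOperator_apply, ContinuousMap.inner_toLp,
      ContinuousMap.inner_toLp]
    simp only [hI, ← integral_conj, ← integral_const_mul, ← integral_mul_const]
    rw [integral_integral_swap_of_hasCompactSupport]
    · refine integral_congr_ae (Filter.Eventually.of_forall fun y => ?_)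
      refine integral_congr_ae (Filter.Eventually.of_forall fun x => ?_)
      simp only [map_mul, ← hf, mul_inv_rev, inv_inv]
      ring
    · simp only [Function.uncurry_def]
      fun_prop
    · exact HasCompactSupport.of_compactSpace _

/-- The operators determine their continuous kernels pointwise; comparing these at (g, 1) and (1, 1)
would give f(g) = f(1). -/
theorem l2Regular_mul_convOperator_ne [μ.WeaklyRegular] (f : C(G, ℂ)) (g : G) (hg : f g ≠ f 1) :
    l2Regular μ g * convOperator μ f ≠ convOperator μ f := by
  intro h
  rw [l2Regular_mul_convOperator] at h
  have h1 : convKernel μ f g = convKernel μ f 1 := by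
    refine ext_inner_right ℂ fun k => ?_
    have h2 := ContinuousMap.toLp_injective μ (DFunLike.congr_fun h k)
    have h3 := DFunLike.congr_fun h2 (1 : G)
    simpa [kernelOperator_apply, ContinuousMap.mulTranslate] using h3
  rw [convKernel_apply, convKernel_apply] at h1
  have h2 := DFunLike.congr_fun (ContinuousMap.toLp_injective μ h1) (1 : G)
  exact hg (by simpa using h2)

end Translation

/-- The continuous characters of a compact Hausdorff abelian group separate its points. -/
theorem exists_circle_character_ne_one {G : Type*} [CommGroup G] [TopologicalSpace G]
    [IsTopologicalGroup G] [CompactSpace G] [T2Space G] (g : G) (hg : g ≠ 1) :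
    ∃ χ : G →ₜ* Circle, χ g ≠ 1 := by
  let _ : MeasurableSpace G := borel G
  have : BorelSpace G := ⟨rfl⟩
  let μ : Measure G := haar
  obtain ⟨u, hu1, hug, hu⟩ := exists_continuous_zero_one_of_isClosed
    (isClosed_singleton (x := (1 : G))) (isClosed_singleton (x := g)) (by simpa using hg.symm)
  -- Symmetrizing makes the convolution operator self-adjoint; positivity of u keeps f(g) ≥ 1 while
  -- f(1) = 0.
  let f : C(G, ℂ) := ⟨fun x => ((u x + u x⁻¹ : ℝ) : ℂ), by fun_prop⟩
  have hf : ∀ x, f x⁻¹ = starRingEnd ℂ (f x) := fun x => by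
    simp [f, add_comm]
  have hfg : f g ≠ f 1 := by
    have h1 : u 1 = 0 := hu1 rfl
    have h2 : u g = 1 := hug rfl
    have h3 := (hu g⁻¹).1
    simp only [f, ContinuousMap.coe_mk, inv_one, h1, h2, Ne, Complex.ofReal_inj]
    linarith
  exact exists_circle_character_of_unitary (l2Regular μ) (star_l2Regular μ)
    (fun g h => (Commute.all g h).map _) (convOperator μ f) (isSelfAdjoint_convOperator μ f hf)
    (commute_l2Regular_convOperator μ f) (continuous_l2Regular_mul_convOperator μ f) g
    (l2Regular_mul_convOperator_ne μ f g hfg)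

end Characters

/-! ### Closed subgroups of the circle -/

/-- A closed subgroup of the circle is finite or the whole circle. -/
theorem Circle.finite_or_eq_top_of_isClosed (H : Subgroup Circle) (hH : IsClosed (H : Set Circle)) :
    (H : Set Circle).Finite ∨ H = ⊤ := by
  let K : AddSubgroup ℝ := (Subgroup.toAddSubgroup H).comap Circle.expHom
  have hK : ∀ x, x ∈ K ↔ Circle.exp x ∈ H := fun x => Iff.rfl
  rcases K.dense_or_cyclic with hd | ⟨a, ha⟩
  · right
    have hcl : IsClosed (K : Set ℝ) := hH.preimage Circle.exp.continuous
    rw [eq_top_iff]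
    intro z _
    obtain ⟨x, rfl⟩ := Circle.exp_surjective z
    have : x ∈ closure (K : Set ℝ) := hd x
    rwa [hcl.closure_eq] at this
  · left
    rw [← AddSubgroup.zmultiples_eq_closure] at ha
    -- Since 2π is a multiple of the generator a, exp(a) has finite order.
    have h2 : 2 * Real.pi ∈ K := by rw [hK, Circle.exp_two_pi]; exact one_mem H
    rw [ha] at h2
    obtain ⟨n, hn⟩ := AddSubgroup.mem_zmultiples_iff.1 h2
    have hn0 : n ≠ 0 := by rintro rfl; simp [Real.pi_ne_zero] at hn
    have hord : IsOfFinOrder (Circle.exp a) := by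
      rw [isOfFinOrder_iff_zpow_eq_one]
      exact ⟨n, hn0, by rw [← Circle.exp_zsmul, hn, Circle.exp_two_pi]⟩
    refine (hord.finite_zpowers).subset ?_
    intro z hz
    obtain ⟨x, rfl⟩ := Circle.exp_surjective z
    have hx : x ∈ AddSubgroup.zmultiples a := ha ▸ (hK x).2 hz
    obtain ⟨m, rfl⟩ := AddSubgroup.mem_zmultiples_iff.1 hx
    exact ⟨m, (Circle.exp_zsmul _ _).symm⟩

/-! ### Limits of compact groups and successor quotients -/

namespace TopGroupInvSystem

/-- A compact group mapping compatibly onto the terms of a directed system of Hausdorff groups is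
the limit if the projections separate its points. -/
theorem isLimitCone_of_surjective {I : Type v} [Preorder I] [Nonempty I] [IsDirectedOrder I]
    (S : TopGroupInvSystem.{u} I) [∀ i, T2Space (S.obj i)] {H : Type w} [Group H]
    [TopologicalSpace H] [CompactSpace H] (π : ∀ i, H →ₜ* S.obj i)
    (hπ : ∀ i j (h : i ≤ j) x, S.bond h (π j x) = π i x)
    (hsurj : ∀ i, Function.Surjective (π i)) (hinj : ∀ x, (∀ i, π i x = 1) → x = 1) :
    S.IsLimitCone π := by
  let f : H →* S.limit :=
    (MonoidHom.mk' (fun x i => π i x) fun x y => by ext i; simp).codRestrict S.limit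
      fun x i j h => hπ i j h x
  have hf : Continuous f :=
    (continuous_pi fun i => (π i).continuous_toFun).subtype_mk _
  have hbij : Function.Bijective f := by
    constructor
    · rw [injective_iff_map_eq_one]
      intro x hx
      exact hinj x fun i => congrFun (congrArg Subtype.val hx) i
    · rintro ⟨x, hx⟩
      have hcl : ∀ i, IsClosed ((π i) ⁻¹' {x i}) := fun i =>
        isClosed_singleton.preimage (π i).continuous_toFun
      -- A preimage of a thread is a point common to the directed family of nonempty compact fibres.
      obtain ⟨y, hy⟩ := IsCompact.nonempty_iInter_of_directed_nonempty_isCompact_isClosed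
        (fun i => (π i) ⁻¹' {x i})
        (by
          intro i j
          obtain ⟨k, hik, hjk⟩ := exists_ge_ge i j
          refine ⟨k, ?_, ?_⟩
          · intro y hy
            have hy : π k y = x k := hy
            show π i y = x i
            rw [← hπ i k hik, hy, hx i k hik]
          · intro y hy
            have hy : π k y = x k := hy
            show π j y = x j
            rw [← hπ j k hjk, hy, hx j k hjk])
        (fun i => hsurj i (x i)) (fun i => (hcl i).isCompact) hcl
      refine ⟨y, Subtype.ext (funext fun i => ?_)⟩
      exact Set.mem_iInter.1 hy i
  let e : H ≃ S.limit := Equiv.ofBijective f hbij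
  have he : Continuous e := hf
  let h := he.homeoOfEquivCompactToT2
  exact ⟨{ MulEquiv.ofBijective f hbij with
      continuous_toFun := h.continuous
      continuous_invFun := h.symm.continuous }, fun _ _ => rfl⟩

variable {G : Type u} [CommGroup G] [TopologicalSpace G] [IsTopologicalGroup G]

/-- The canonical map between quotients by nested subgroups. -/
def quotientBond {M N : Subgroup G} (h : N ≤ M) : G ⧸ N →ₜ* G ⧸ M where
  toMonoidHom := QuotientGroup.map N M (MonoidHom.id G) h
  continuous_toFun :=
    (QuotientGroup.isQuotientMap_mk (N := N)).continuous_iff.2 QuotientGroup.continuous_mk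

/-- The quotients by a decreasing family of subgroups. -/
def quotientSystem {I : Type v} [Preorder I] (N : I → Subgroup G) (hN : Antitone N) :
    TopGroupInvSystem.{u} I where
  obj i := G ⧸ N i
  bond h := quotientBond (hN h)
  bond_refl i x := by obtain ⟨g, rfl⟩ := QuotientGroup.mk_surjective x; rfl
  bond_bond hij hjk x := by obtain ⟨g, rfl⟩ := QuotientGroup.mk_surjective x; rfl

/-- The projection onto a quotient as a continuous homomorphism. -/
def quotientProj (N : Subgroup G) : G →ₜ* G ⧸ N where
  toMonoidHom := QuotientGroup.mk' N
  continuous_toFun := continuous_quot_mk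

/-- Cutting a compact group down by the kernel of one more character is either a finite kernel
epimorphism or a circle projection. -/
theorem quotientBond_inf_ker [CompactSpace G] {M N : Subgroup G} (h : N ≤ M)
    (hM : IsClosed (M : Set G)) (χ : G →ₜ* Circle)
    (hN : N = M ⊓ χ.toMonoidHom.ker) :
    IsFiniteKernelEpi (quotientBond h) ∨ IsCircleProjection (quotientBond h) := by
  have hχN : N ≤ χ.toMonoidHom.ker := hN ▸ inf_le_right
  let χ' : G ⧸ N →* Circle := QuotientGroup.lift N χ.toMonoidHom hχN
  have hχ' : Continuous χ' := χ.continuous_toFun.quotient_lift _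
  have hker : ∀ x : G ⧸ N, quotientBond h x = 1 → χ' x = 1 → x = 1 := by
    intro x hx hx'
    obtain ⟨g, rfl⟩ := QuotientGroup.mk_surjective x
    rw [QuotientGroup.eq_one_iff, hN]
    exact ⟨(QuotientGroup.eq_one_iff g).1 hx, hx'⟩
  have himg : IsClosed ((M.map χ.toMonoidHom : Subgroup Circle) : Set Circle) :=
    (hM.isCompact.image χ.continuous_toFun).isClosed
  have hsurj : Function.Surjective (quotientBond h) := by
    intro x
    obtain ⟨g, rfl⟩ := QuotientGroup.mk_surjective x
    exact ⟨(g : G ⧸ N), rfl⟩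
  rcases Circle.finite_or_eq_top_of_isClosed _ himg with hfin | htop
  · left
    refine ⟨hsurj, ?_⟩
    refine Set.Finite.of_finite_image (f := χ') (hfin.subset ?_) ?_
    · rintro _ ⟨x, hx, rfl⟩
      obtain ⟨g, rfl⟩ := QuotientGroup.mk_surjective x
      exact ⟨g, (QuotientGroup.eq_one_iff g).1 hx, rfl⟩
    · intro x hx y hy hxy
      have hx : quotientBond h x = 1 := hx
      have hy : quotientBond h y = 1 := hy
      rw [← div_eq_one]
      refine hker _ ?_ ?_
      · rw [map_div, hx, hy, div_one]
      · rw [map_div, hxy, div_self']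
  · right
    -- Makes G/M Hausdorff by instance search, as needed for the compact-to-Hausdorff homeomorphism
    -- below.
    have : IsClosed (M : Set G) := hM
    let f : G ⧸ N →* (G ⧸ M) × Circle := (quotientBond h).toMonoidHom.prod χ'
    have hf : Continuous f := (quotientBond h).continuous_toFun.prodMk hχ'
    have hbij : Function.Bijective f := by
      constructor
      · rw [injective_iff_map_eq_one]
        intro x hx
        exact hker x (congrArg Prod.fst hx) (congrArg Prod.snd hx)
      · rintro ⟨x, z⟩
        obtain ⟨g, rfl⟩ := QuotientGroup.mk_surjective x
        -- Multiplying the lift g by m ∈ M corrects its character value without changing its class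
        -- mod M.
        obtain ⟨m, hm, hmz⟩ : z / χ g ∈ M.map χ.toMonoidHom := htop ▸ Subgroup.mem_top _
        refine ⟨((g * m : G) : G ⧸ N), Prod.ext ?_ ?_⟩
        · show ((g * m : G) : G ⧸ M) = g
          rw [QuotientGroup.mk_mul, (QuotientGroup.eq_one_iff m).2 hm, mul_one]
        · show χ (g * m) = z
          have hmz : χ m = z / χ g := hmz
          rw [map_mul, hmz, mul_div_cancel]
    let e : G ⧸ N ≃ (G ⧸ M) × Circle := Equiv.ofBijective f hbij
    have he : Continuous e := hf
    let h' := he.homeoOfEquivCompactToT2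
    exact ⟨{ MulEquiv.ofBijective f hbij with
      continuous_toFun := h'.continuous
      continuous_invFun := h'.symm.continuous }, fun _ => rfl⟩

end TopGroupInvSystem

/-! ### Weight and the number of characters needed -/

theorem exists_isTopologicalBasis_mk_eq_topWeight (X : Type u) [TopologicalSpace X] :
    ∃ B : Set (Set X), TopologicalSpace.IsTopologicalBasis B ∧ Cardinal.mk B = topWeight X :=
  csInf_mem (s := {c | ∃ B : Set (Set X), TopologicalSpace.IsTopologicalBasis B ∧
    Cardinal.mk B = c}) ⟨_, _, TopologicalSpace.isTopologicalBasis_opens, rfl⟩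

/-- A compact group that is not a Lie group has infinite weight. -/
theorem aleph0_le_topWeight {G : Type u} [Group G] [TopologicalSpace G] [IsTopologicalGroup G]
    [CompactSpace G] [T2Space G] (hG : ¬ IsCompactLieGroup G) :
    Cardinal.aleph0 ≤ topWeight G := by
  by_contra! h
  obtain ⟨B, hB, hBc⟩ := exists_isTopologicalBasis_mk_eq_topWeight G
  have hBf : B.Finite := by
    rw [← Set.finite_coe_iff, ← Cardinal.lt_aleph0_iff_finite, hBc]; exact h
  have : Finite G := by
    have : Finite B := hBf
    -- A point is determined by the basic sets containing it.
    refine Finite.of_injective (fun x : G => {b : B | x ∈ (b : Set G)}) fun x y hxy => ?_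
    by_contra hne
    obtain ⟨b, hb, hxb, hby⟩ := hB.exists_subset_of_mem_open (a := x) (u := {y}ᶜ)
      hne isClosed_singleton.isOpen_compl
    have : y ∈ b := (Set.ext_iff.1 hxy ⟨b, hb⟩).1 hxb
    exact hby this rfl
  refine hG ⟨‹_›, ‹_›, {1}, ?_, fun H hH => ?_⟩
  · rw [nhds_discrete]; rfl
  · exact (Subgroup.eq_bot_iff_forall H).2 fun x hx => hH hx

/-- A compact abelian group has a separating family of characters indexed by a base. -/
theorem exists_separating_characters (G : Type u) [CommGroup G] [TopologicalSpace G]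
    [IsTopologicalGroup G] [CompactSpace G] [T2Space G] {B : Set (Set G)}
    (hB : TopologicalSpace.IsTopologicalBasis B) :
    ∃ χ : B → (G →ₜ* Circle), ∀ g, (∀ b, χ b g = 1) → g = 1 := by
  -- For each basic set, pick a character avoiding 1 on all of it if one exists, and the trivial
  -- character otherwise.
  choose χ hχ using fun b : B => show ∃ χ : G →ₜ* Circle,
      (∃ ψ : G →ₜ* Circle, ∀ x ∈ (b : Set G), ψ x ≠ 1) → ∀ x ∈ (b : Set G), χ x ≠ 1 by
    by_cases h : ∃ ψ : G →ₜ* Circle, ∀ x ∈ (b : Set G), ψ x ≠ 1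
    · exact h.imp fun ψ hψ _ => hψ
    · exact ⟨1, fun h' => absurd h' h⟩
  refine ⟨χ, fun g hg => ?_⟩
  by_contra hne
  obtain ⟨ψ, hψ⟩ := exists_circle_character_ne_one g hne
  obtain ⟨b, hb, hgb, hbs⟩ := hB.exists_subset_of_mem_open (a := g) (u := ψ ⁻¹' {1}ᶜ) hψ
    (isClosed_singleton.isOpen_compl.preimage ψ.continuous_toFun)
  exact hχ ⟨b, hb⟩ ⟨ψ, fun x hx => hbs hx⟩ g hgb (hg ⟨b, hb⟩)

/-! ### The decreasing filtration by common kernels -/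

section KernelFiltration

variable {G : Type u} [CommGroup G] [TopologicalSpace G]

/-- The common kernel of the characters with index below `α`. -/
noncomputable def commonKernel (χ : Ordinal.{u} → (G →ₜ* Circle)) (α : Ordinal.{u}) : Subgroup G :=
  ⨅ β < α, (χ β).toMonoidHom.ker

theorem mem_commonKernel {χ : Ordinal.{u} → (G →ₜ* Circle)} {α : Ordinal.{u}} {g : G} :
    g ∈ commonKernel χ α ↔ ∀ β < α, χ β g = 1 := by
  simp only [commonKernel, Subgroup.mem_iInf]
  rfl

theorem commonKernel_antitone (χ : Ordinal.{u} → (G →ₜ* Circle)) : Antitone (commonKernel χ) :=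
  fun _ _ h _ hg => mem_commonKernel.2 fun β hβ => mem_commonKernel.1 hg β (hβ.trans_le h)

theorem isClosed_commonKernel (χ : Ordinal.{u} → (G →ₜ* Circle)) (α : Ordinal.{u}) :
    IsClosed (commonKernel χ α : Set G) := by
  have : (commonKernel χ α : Set G) = ⋂ β, ⋂ (_ : β < α), χ β ⁻¹' {1} := by
    ext g; simp [mem_commonKernel]
  rw [this]
  exact isClosed_iInter fun β => isClosed_iInter fun _ =>
    isClosed_singleton.preimage (χ β).continuous_toFun

theorem commonKernel_add_one (χ : Ordinal.{u} → (G →ₜ* Circle)) (α : Ordinal.{u}) :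
    commonKernel χ (α + 1) = commonKernel χ α ⊓ (χ α).toMonoidHom.ker := by
  ext g
  rw [Subgroup.mem_inf, mem_commonKernel, mem_commonKernel]
  constructor
  · exact fun h => ⟨fun β hβ => h β (hβ.trans (Order.lt_add_one_iff.2 le_rfl)),
      h α (Order.lt_add_one_iff.2 le_rfl)⟩
  · rintro ⟨h, hα⟩ β hβ
    rcases (Order.lt_add_one_iff.1 hβ).lt_or_eq with hlt | rfl
    · exact h β hlt
    · exact hα

end KernelFiltration

/-! ### Assembling the sequence -/

theorem mainTheorem4 (G : Type u) [CommGroup G] [TopologicalSpace G] [IsTopologicalGroup G]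
    [CompactSpace G] [T2Space G] :
    ∃ (κ : Ordinal.{u}) (hκ : 0 < κ) (S : TopGroupInvSystem.{u} (Set.Iio κ)),
      (∀ α, CompactSpace (S.obj α) ∧ T2Space (S.obj α)) ∧
      S.IsContinuousSeq ∧
      (∃ π : ∀ α, G →ₜ* S.obj α, S.IsLimitCone π) ∧
      Subsingleton (S.obj ⟨0, hκ⟩) ∧
      (∀ (α : Ordinal.{u}) (h : α + 1 < κ),
        IsFiniteKernelEpi (S.succBond α h) ∨ IsCircleProjection (S.succBond α h)) ∧
      (¬ IsCompactLieGroup G → κ = (topWeight G).ord) := by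
  obtain ⟨B, hB, hBc⟩ := exists_isTopologicalBasis_mk_eq_topWeight G
  obtain ⟨χB, hχB⟩ := exists_separating_characters G hB
  -- The bound ℵ₀ makes the length a limit ordinal, leaving room for the index j b + 1 of each
  -- character.
  let c : Cardinal.{u} := max Cardinal.aleph0 (topWeight G)
  have hlim : Order.IsSuccLimit c.ord := Cardinal.isSuccLimit_ord (le_max_left _ _)
  have hκ : 0 < c.ord := hlim.bot_lt
  obtain ⟨j, hj, hjc⟩ : ∃ j : B → Ordinal.{u}, Function.Injective j ∧ ∀ b, j b < c.ord := by
    have h : Cardinal.mk B ≤ Cardinal.mk c.ord.ToType := by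
      rw [Cardinal.mk_toType, Cardinal.card_ord, hBc]; exact le_max_right _ _
    obtain ⟨i⟩ := h
    exact ⟨fun b => (i b).toOrd,
      Subtype.val_injective.comp (Ordinal.ToType.mk.symm.injective.comp i.injective),
      fun b => (i b).toOrd.2⟩
  -- Unused indices get the trivial character, whose successor step is an isomorphism and so has
  -- finite kernel.
  let χ : Ordinal.{u} → (G →ₜ* Circle) := Function.extend j χB fun _ => 1
  have hχ : ∀ b, χ (j b) = χB b := fun b => hj.extend_apply _ _ _
  let N : Set.Iio c.ord → Subgroup G := fun α => commonKernel χ α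
  have hN : Antitone N := fun α β h => commonKernel_antitone χ h
  have hcl : ∀ α, IsClosed (N α : Set G) := fun α => isClosed_commonKernel χ α
  let S := TopGroupInvSystem.quotientSystem N hN
  have hT2 : ∀ α, T2Space (S.obj α) := fun α => by
    have := hcl α
    exact inferInstanceAs (T2Space (G ⧸ N α))
  have hcpt : ∀ α, CompactSpace (S.obj α) := fun α => inferInstanceAs (CompactSpace (G ⧸ N α))
  refine ⟨c.ord, hκ, S, fun α => ⟨hcpt α, hT2 α⟩, ?_, ?_, ?_, ?_, ?_⟩
  · intro δ hδ
    have : Nonempty (Set.Iio δ) := ⟨⟨⟨0, hκ⟩, hδ.bot_lt⟩⟩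
    have (i : Set.Iio δ) : T2Space ((S.restrict (Set.Iio δ)).obj i) := hT2 i
    have := hcpt δ
    refine TopGroupInvSystem.isLimitCone_of_surjective _ _
      (fun i k h x => S.bond_bond h (le_of_lt k.2) x) (fun i x => ?_) fun x hx => ?_
    · obtain ⟨g, rfl⟩ := QuotientGroup.mk_surjective x
      exact ⟨(g : G ⧸ N δ), rfl⟩
    · obtain ⟨g, rfl⟩ := QuotientGroup.mk_surjective x
      refine (QuotientGroup.eq_one_iff g).2 (mem_commonKernel.2 fun β hβ => ?_)
      -- N_{β+1}, not N_β, is the stage guaranteed to lie in the kernel of χ_β.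
      have hβ' : β + 1 < (δ : Ordinal.{u}) := hδ.add_one_lt hβ
      have hg := (QuotientGroup.eq_one_iff g).1 (hx ⟨⟨β + 1, hβ'.trans δ.2⟩, hβ'⟩)
      exact mem_commonKernel.1 hg β (Order.lt_add_one_iff.2 le_rfl)
  · have : Nonempty (Set.Iio c.ord) := ⟨⟨0, hκ⟩⟩
    refine ⟨fun α => TopGroupInvSystem.quotientProj (N α),
      TopGroupInvSystem.isLimitCone_of_surjective _ _ (fun i k h x => rfl)
      (fun i x => QuotientGroup.mk_surjective x) fun g hg => hχB g fun b => ?_⟩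
    have hb := (QuotientGroup.eq_one_iff g).1 (hg ⟨j b + 1, hlim.add_one_lt (hjc b)⟩)
    rw [← hχ]
    exact mem_commonKernel.1 hb _ (Order.lt_add_one_iff.2 le_rfl)
  · have h0 : N ⟨0, hκ⟩ = ⊤ := by
      rw [eq_top_iff]
      exact fun g _ => mem_commonKernel.2 fun β hβ => absurd hβ not_lt_zero
    exact QuotientGroup.subsingleton_iff.2 h0
  · intro α h
    exact TopGroupInvSystem.quotientBond_inf_ker _ (hcl _) (χ α) (commonKernel_add_one χ α)
  · intro hG
    have : c = topWeight G := max_eq_right (aleph0_le_topWeight hG)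
    rw [this]
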